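/- Let $\mathbf U$ be the quantum group of $\mathfrak{sl}_2$ over $\mathbb Q(q)$: the unital associative algebra generated by $E,F,K^{\pm1}$ with relations $KK^{-1}=K^{-1}K=1$, $KE=q^2EK$, $KF=q^{-2}FK$, $EF-FE=\frac{K-K^{-1}}{q-q^{-1}}$. Let $\Delta:\mathbf U\to\mathbf U\otimes\mathbf U$ be the comultiplication, i.e. the algebra homomorphism with $$\Delta(E)=E\otimes 1+K\otimes E,\qquad \Delta(F)=1\otimes F+F\otimes K^{-1},\qquad \Delta(K)=K\otimes K.$$ Write $[n]=\frac{q^n-q^{-n}}{q-q^{-1}}$, $[n]!=[1][2]\cdots[n]$, and $x^{(n)}=x^n/[n]!$ for $x\in\mathbf U$, $n\ge0$. Fix $\varsigma\in\mathbb Q(q)^\times$ and put $\check E=\varsigma EK^{-1}$ and $B=F+\varsigma EK^{-1}$. The even $\imath$-divided powers are, for $k\ge 0$, $$B_{\mathrm{ev}}^{(2k)}=\frac1{[2k]!}\prod_{j=1}^{k}\bigl(B^2-q\varsigma[2j-2]^2\bigr),\qquad B_{\mathrm{ev}}^{(2k+1)}=\frac{1}{[2k+1]!}\,B\prod_{j=1}^{k}\bigl(B^2-q\varsigma[2j]^2\bigr).$$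 For $a\in\mathbb Z$ and $n\ge 0$ set $$\begin{bmatrix}h;a\\ n\end{bmatrix}=\prod_{i=1}^n\frac{q^{4a+4i-4}K^{-2}-1}{q^{4i}-1}.$$ Proposition. For every even integer $n\ge 0$, $$\Delta(B_{\mathrm{ev}}^{(n)})=\sum_{r=0}^n B_{\mathrm{ev}}^{(n-r)}\otimes\Bigl(\sum_{c=0}^{\lfloor r/2\rfloor}\sum_{a=0}^{r-2c}(-1)^cq^{3c-(r-2c)(r-n)+a(r-2c-a)}(q\varsigma)^c\,F^{(a)}\begin{bmatrix}h;1-c+\lfloor\frac{r-2}2\rfloor\\ c\end{bmatrix}K^{r-n}\check E^{(r-2c-a)}\Bigr),$$ and for every odd integer $n\ge 1$, $$\Delta(B_{\mathrm{ev}}^{(n)})=\sum_{r=0}^n B_{\mathrm{ev}}^{(n-r)}\otimes\Bigl(\sum_{c=0}^{\lfloor r/2\rfloor}\sum_{a=0}^{r-2c}(-1)^cq^{c-(r-2c)(r-n)+a(r-2c-a)}(q\varsigma)^c\,F^{(a)}\begin{bmatrix}h;1-c+\lfloor\frac{r-1}2\rfloor\\ c\end{bmatrix}K^{r-n}\check E^{(r-2c-a)}\Bigr).$$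 -/

import Mathlib

open scoped TensorProduct

noncomputable section

namespace QSl2

/-- The base field `ℚ(q)`. -/
abbrev Qq : Type := RatFunc ℚ

/-- The indeterminate `q`. -/
def q : Qq := RatFunc.X

/-- The quantum integer `[n] = (q^n - q^(-n)) / (q - q⁻¹)`. -/
def qInt (n : ℤ) : Qq := (q ^ n - q ^ (-n)) / (q - q⁻¹)

/-- The quantum factorial `[n]! = [1] [2] ⋯ [n]`. -/
def qFact (n : ℕ) : Qq := ∏ i ∈ Finset.Icc 1 n, qInt (i : ℤ)

/-- The four generators of the quantum group of `sl₂`. -/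
inductive Gen : Type
  | E | F | K | Kinv

/-- The defining relations of the quantum group of `sl₂`. -/
inductive Rel : FreeAlgebra Qq Gen → FreeAlgebra Qq Gen → Prop
  | K_Kinv : Rel (FreeAlgebra.ι Qq Gen.K * FreeAlgebra.ι Qq Gen.Kinv) 1
  | Kinv_K : Rel (FreeAlgebra.ι Qq Gen.Kinv * FreeAlgebra.ι Qq Gen.K) 1
  | K_E : Rel (FreeAlgebra.ι Qq Gen.K * FreeAlgebra.ι Qq Gen.E)
      (q ^ 2 • (FreeAlgebra.ι Qq Gen.E * FreeAlgebra.ι Qq Gen.K))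
  | K_F : Rel (FreeAlgebra.ι Qq Gen.K * FreeAlgebra.ι Qq Gen.F)
      ((q ^ 2)⁻¹ • (FreeAlgebra.ι Qq Gen.F * FreeAlgebra.ι Qq Gen.K))
  | E_F : Rel (FreeAlgebra.ι Qq Gen.E * FreeAlgebra.ι Qq Gen.F
        - FreeAlgebra.ι Qq Gen.F * FreeAlgebra.ι Qq Gen.E)
      ((q - q⁻¹)⁻¹ • (FreeAlgebra.ι Qq Gen.K - FreeAlgebra.ι Qq Gen.Kinv))

/-- The quantum group `U = U_q(sl₂)` over `ℚ(q)`, by generators and relations. -/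
def U : Type := RingQuot Rel

instance : Ring U := inferInstanceAs (Ring (RingQuot Rel))

instance : Algebra Qq U := inferInstanceAs (Algebra Qq (RingQuot Rel))

/-- The quotient map from the free algebra. -/
def mk : FreeAlgebra Qq Gen →ₐ[Qq] U := RingQuot.mkAlgHom Qq Rel

theorem mk_rel {x y : FreeAlgebra Qq Gen} (h : Rel x y) : mk x = mk y :=
  RingQuot.mkAlgHom_rel Qq h

/-- The generator `E`. -/
def E : U := mk (FreeAlgebra.ι Qq Gen.E)

/-- The generator `F`. -/
def F : U := mk (FreeAlgebra.ι Qq Gen.F)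

/-- The generator `K`, as a unit of `U`, with inverse the generator `K⁻¹`. -/
def K : Uˣ where
  val := mk (FreeAlgebra.ι Qq Gen.K)
  inv := mk (FreeAlgebra.ι Qq Gen.Kinv)
  val_inv := by rw [← map_mul, mk_rel Rel.K_Kinv, map_one]
  inv_val := by rw [← map_mul, mk_rel Rel.Kinv_K, map_one]

theorem q_ne_zero : q ≠ 0 := RatFunc.X_ne_zero

theorem K_mul_E : (K : U) * E = q ^ 2 • (E * (K : U)) := by
  have h := mk_rel Rel.K_E
  rwa [map_mul, map_smul, map_mul] at h

theorem K_mul_F : (K : U) * F = (q ^ 2)⁻¹ • (F * (K : U)) := by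
  have h := mk_rel Rel.K_F
  rwa [map_mul, map_smul, map_mul] at h

theorem E_mul_F : E * F - F * E = (q - q⁻¹)⁻¹ • ((K : U) - ((K⁻¹ : Uˣ) : U)) := by
  have h := mk_rel Rel.E_F
  rwa [map_sub, map_mul, map_mul, map_smul, map_sub] at h

theorem E_mul_Kinv : E * ((K⁻¹ : Uˣ) : U) = q ^ 2 • (((K⁻¹ : Uˣ) : U) * E) := by
  rw [Units.mul_inv_eq_iff_eq_mul, smul_mul_assoc, mul_assoc, ← mul_smul_comm, ← K_mul_E,
    Units.inv_mul_cancel_left]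

/-- The comultiplication on generators. -/
def comulGen : Gen → U ⊗[Qq] U
  | Gen.E => E ⊗ₜ[Qq] 1 + (K : U) ⊗ₜ[Qq] E
  | Gen.F => 1 ⊗ₜ[Qq] F + F ⊗ₜ[Qq] ((K⁻¹ : Uˣ) : U)
  | Gen.K => (K : U) ⊗ₜ[Qq] (K : U)
  | Gen.Kinv => ((K⁻¹ : Uˣ) : U) ⊗ₜ[Qq] ((K⁻¹ : Uˣ) : U)

theorem comulGen_rel {x y : FreeAlgebra Qq Gen} (h : Rel x y) :
    FreeAlgebra.lift Qq comulGen x = FreeAlgebra.lift Qq comulGen y := by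
  have hq : (q ^ 2 : Qq) ≠ 0 := pow_ne_zero _ q_ne_zero
  induction h with
  | K_Kinv => simp [comulGen, Algebra.TensorProduct.one_def]
  | Kinv_K => simp [comulGen, Algebra.TensorProduct.one_def]
  | K_E =>
    simp [comulGen, mul_add, add_mul, K_mul_E, TensorProduct.smul_tmul']
  | K_F =>
    simp [comulGen, mul_add, add_mul, K_mul_F, TensorProduct.smul_tmul']
  | E_F =>
    have h1 : ((K : U) * F) ⊗ₜ[Qq] (E * ((K⁻¹ : Uˣ) : U))
        = (F * (K : U)) ⊗ₜ[Qq] (((K⁻¹ : Uˣ) : U) * E) := by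
      rw [K_mul_F, E_mul_Kinv, TensorProduct.smul_tmul_smul, inv_mul_cancel₀ hq, one_smul]
    have h2 : E * F = F * E + (q - q⁻¹)⁻¹ • ((K : U) - ((K⁻¹ : Uˣ) : U)) := by
      rw [← E_mul_F]; abel
    simp only [map_sub, map_mul, map_smul, FreeAlgebra.lift_ι_apply, comulGen, mul_add, add_mul,
      Algebra.TensorProduct.tmul_mul_tmul, one_mul, mul_one, h1, h2, TensorProduct.tmul_add,
      TensorProduct.add_tmul, TensorProduct.tmul_sub, TensorProduct.sub_tmul,
      TensorProduct.tmul_smul, TensorProduct.smul_tmul', smul_sub]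
    abel

/-- The comultiplication `Δ : U → U ⊗ U`, an algebra homomorphism. -/
def comul : U →ₐ[Qq] U ⊗[Qq] U :=
  RingQuot.liftAlgHom Qq ⟨FreeAlgebra.lift Qq comulGen, fun _ _ h => comulGen_rel h⟩

theorem comul_mk (x : FreeAlgebra Qq Gen) :
    comul (mk x) = FreeAlgebra.lift Qq comulGen x :=
  RingQuot.liftAlgHom_mkAlgHom_apply Qq _ _ x

theorem comul_E : comul E = E ⊗ₜ[Qq] 1 + (K : U) ⊗ₜ[Qq] E := by
  simp [E, comul_mk, comulGen]

theorem comul_F : comul F = 1 ⊗ₜ[Qq] F + F ⊗ₜ[Qq] ((K⁻¹ : Uˣ) : U) := by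
  rw [show comul F = _ from comul_mk _]; simp [comulGen]

theorem comul_K : comul (K : U) = (K : U) ⊗ₜ[Qq] (K : U) := by
  rw [show comul (K : U) = _ from comul_mk _]; simp [comulGen]

/-- The divided power `x^(n) = x^n / [n]!`. -/
def divPow (x : U) (n : ℕ) : U := (qFact n)⁻¹ • x ^ n

/-- The element `Ě = ς E K⁻¹`. -/
def Echeck (ς : Qq) : U := ς • (E * ((K⁻¹ : Uˣ) : U))

/-- The generator `B = F + ς E K⁻¹` of the `ı`quantum group. -/
def B (ς : Qq) : U := F + ς • (E * ((K⁻¹ : Uˣ) : U))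

/-- The even `ı`-divided power:
`B_ev^(n) = (1/[n]!) B ∏_{j=1}^k (B² - qς [2j]²)` for `n = 2k+1` and
`B_ev^(n) = (1/[n]!) ∏_{j=1}^k (B² - qς [2j-2]²)` for `n = 2k`.
In the lists of factors the index is `i = j - 1`. -/
def Bev (ς : Qq) (n : ℕ) : U :=
  (qFact n)⁻¹ •
    if Odd n then
      B ς * ((List.range (n / 2)).map fun i : ℕ =>
        B ς ^ 2 - algebraMap Qq U (q * ς * qInt (2 * ((i : ℤ) + 1)) ^ 2)).prod
    else
      ((List.range (n / 2)).map fun i : ℕ =>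
        B ς ^ 2 - algebraMap Qq U (q * ς * qInt (2 * ((i : ℤ) + 1) - 2) ^ 2)).prod

/-- The Cartan binomial `[h;a choose n] = ∏_{i=1}^n (q^(4a+4i-4) K⁻² - 1) / (q^(4i) - 1)`.
In the list of factors the index is `j = i - 1`. -/
def hBinom (a : ℤ) (n : ℕ) : U :=
  ((List.range n).map fun j : ℕ =>
    (q ^ (4 * ((j : ℤ) + 1)) - 1)⁻¹ •
      (q ^ (4 * a + 4 * ((j : ℤ) + 1) - 4) • ((K ^ (-2 : ℤ) : Uˣ) : U) - 1)).prod

end QSl2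

end

/-! The proof is an induction on n driven by the recursion for B · B_ev^(m): it equals [m+1]
B_ev^(m+1), plus qς[m] B_ev^(m-1) when m is even (`B_mul_extZ_Bev`). Since Δ(B) = B⊗K⁻¹ + 1⊗F + 1⊗Ě
(`comul_B`), it is enough that the right-hand sides satisfy the same recursion under left
multiplication by Δ(B).

With b = r - 2c - a, the right-hand side is a finitely supported sum over all (a, b, c) ∈ ℤ³ of
B_ev^(n-a-b-2c) ⊗ (scalar) F^(a) [h; α; c] K^(a+b+2c-n) Ě^(b), everything being zero at negative
indices. Multiplying by Δ(B) gives five families of terms. Translating four of them in ℤ³ gives all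
five the same left factor B_ev^(n+1-a-b-2c), so the claim may be checked on right factors, one
triple at a time.

For a fixed triple the right factors share F^(a), K^s and Ě^(b) and differ only in their Cartan
parts. Two Pascal-type identities (`hBinomZ_add_one`, `hBinomZ_sub_one`) express these parts through
[h; k; c] and K⁻²[h; k+1; c-1]. Equality of the two coefficients is then a rational identity in q, ς
and powers of q, proved according to the parities of n and a+b (`summand_recursion_of_odd`,
`summand_recursion_of_even`). -/

noncomputable section

namespace QSl2

/-- The canonical `ℕ`-algebra structure on `ℚ(q)`, preferred to the one through polynomials. -/
instance natAlgebra : Algebra ℕ Qq := Semiring.toNatAlgebra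

/-- The canonical `ℤ`-algebra structure on `ℚ(q)`, preferred to the one through polynomials. -/
instance intAlgebra : Algebra ℤ Qq := Ring.toIntAlgebra Qq

/-! ### Nonvanishing of quantum integers; divided powers -/

theorem q_pow_ne_one {n : ℕ} (hn : n ≠ 0) : q ^ n ≠ 1 := by
  intro h
  have h1 : algebraMap (Polynomial ℚ) (RatFunc ℚ) (Polynomial.X ^ n) =
      algebraMap (Polynomial ℚ) (RatFunc ℚ) 1 := by
    rw [map_pow, RatFunc.algebraMap_X, map_one]; exact h
  have h2 := congrArg Polynomial.natDegree (RatFunc.algebraMap_injective ℚ h1)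
  rw [Polynomial.natDegree_X_pow, Polynomial.natDegree_one] at h2
  exact hn h2

theorem q_sub_inv_ne_zero : q - q⁻¹ ≠ 0 := by
  intro h
  refine q_pow_ne_one (n := 2) (by norm_num) ?_
  have h0 := q_ne_zero
  field_simp at h
  linear_combination h

theorem qInt_zero : qInt 0 = 0 := by simp [qInt]

theorem qInt_ne_zero {n : ℕ} (hn : n ≠ 0) : qInt n ≠ 0 := by
  intro h
  rw [qInt, div_eq_zero_iff, or_iff_left q_sub_inv_ne_zero, zpow_neg, zpow_natCast] at h
  refine q_pow_ne_one (n := 2 * n) (by omega) ?_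
  have h0 : q ^ n ≠ 0 := pow_ne_zero _ q_ne_zero
  field_simp at h
  rw [pow_mul']
  linear_combination h

theorem qFact_succ (n : ℕ) : qFact (n + 1) = qFact n * qInt (n + 1) := by
  rw [qFact, Finset.prod_Icc_succ_top (by omega)]; simp [qFact]

theorem qFact_ne_zero (n : ℕ) : qFact n ≠ 0 := by
  rw [qFact, Finset.prod_ne_zero_iff]
  intro i hi
  exact qInt_ne_zero (by have := (Finset.mem_Icc.1 hi).1; omega)

theorem mul_divPow (x : U) (n : ℕ) : x * divPow x n = qInt (n + 1) • divPow x (n + 1) := by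
  have h : qInt ((n : ℤ) + 1) ≠ 0 := by exact_mod_cast qInt_ne_zero n.succ_ne_zero
  have h' := qFact_ne_zero n
  rw [divPow, divPow, mul_smul_comm, smul_smul, qFact_succ, pow_succ']
  congr 1
  field_simp

/-- Extension by zero to negative integer indices. -/
def extZ {M : Type*} [Zero M] (f : ℕ → M) (a : ℤ) : M := if 0 ≤ a then f a.toNat else 0

theorem extZ_natCast {M : Type*} [Zero M] (f : ℕ → M) (n : ℕ) : extZ f n = f n := by
  simp [extZ]

theorem extZ_of_neg {M : Type*} [Zero M] (f : ℕ → M) {a : ℤ} (ha : a < 0) : extZ f a = 0 := by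
  simp [extZ, ha]

/-- Extension by zero respects the recursion because at a = -1, where x^(0) = 1 would appear, its
coefficient is [0] = 0. -/
theorem mul_extZ_divPow (x : U) (a : ℤ) :
    x * extZ (divPow x) a = qInt (a + 1) • extZ (divPow x) (a + 1) := by
  rcases lt_or_ge a 0 with h | h
  · rw [extZ_of_neg _ h, mul_zero]
    rcases eq_or_ne a (-1) with rfl | h1
    · simp [qInt_zero]
    · rw [extZ_of_neg _ (by omega), smul_zero]
  · lift a to ℕ using h
    rw [extZ_natCast, mul_divPow]
    congr 1

/-! ### Commutation relations in U -/

theorem Kinv_mul_F : ((K⁻¹ : Uˣ) : U) * F = q ^ 2 • (F * ((K⁻¹ : Uˣ) : U)) := by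
  have h : (K : U) * (F * ((K⁻¹ : Uˣ) : U)) = (q ^ 2)⁻¹ • F := by
    rw [← mul_assoc, K_mul_F, smul_mul_assoc, mul_assoc, Units.mul_inv, mul_one]
  rw [Units.inv_mul_eq_iff_eq_mul, mul_smul_comm, h, smul_inv_smul₀ (pow_ne_zero _ q_ne_zero)]

theorem Kinv_mul_F_pow (n : ℕ) :
    ((K⁻¹ : Uˣ) : U) * F ^ n = q ^ (2 * n) • (F ^ n * ((K⁻¹ : Uˣ) : U)) := by
  induction n with
  | zero => simp
  | succ n ih =>
    rw [pow_succ, ← mul_assoc, ih, smul_mul_assoc, mul_assoc, Kinv_mul_F, mul_smul_comm, smul_smul,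
      ← pow_add, mul_assoc]
    rfl

theorem Kinv_mul_extZ (a : ℤ) : ((K⁻¹ : Uˣ) : U) * extZ (divPow F) a =
    q ^ (2 * a) • (extZ (divPow F) a * ((K⁻¹ : Uˣ) : U)) := by
  rcases lt_or_ge a 0 with h | h
  · simp [extZ_of_neg _ h]
  · lift a to ℕ using h
    rw [extZ_natCast, divPow, mul_smul_comm, Kinv_mul_F_pow, smul_mul_assoc, smul_comm]
    congr 1

/-- The element `K⁻²`. -/
def Ki2 : U := ((K ^ (-2 : ℤ) : Uˣ) : U)

theorem Ki2_eq : Ki2 = ((K⁻¹ : Uˣ) : U) * ((K⁻¹ : Uˣ) : U) := by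
  rw [← Units.val_mul, Ki2]
  congr 1
  group

theorem Ki2_mul_F_pow (n : ℕ) : Ki2 * F ^ n = q ^ (4 * n) • (F ^ n * Ki2) := by
  rw [Ki2_eq, mul_assoc, Kinv_mul_F_pow, mul_smul_comm, ← mul_assoc, Kinv_mul_F_pow,
    smul_mul_assoc, smul_smul, ← pow_add, mul_assoc]
  congr 2
  ring

theorem Echeck_mul_F (ς : Qq) : Echeck ς * F =
    q ^ 2 • (F * Echeck ς) + (ς * q ^ 2 / (q - q⁻¹)) • (1 - Ki2) := by
  have h2 : E * F = F * E + (q - q⁻¹)⁻¹ • ((K : U) - ((K⁻¹ : Uˣ) : U)) := by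
    rw [← E_mul_F]; abel
  rw [Echeck, smul_mul_assoc, mul_assoc, Kinv_mul_F, mul_smul_comm, ← mul_assoc, h2, add_mul,
    smul_mul_assoc, sub_mul, Units.mul_inv, ← Ki2_eq, mul_smul_comm, mul_assoc]
  module

/-- Each of the n+1 factors F that Ě passes leaves a multiple of 1 - K⁻². Moving these to the right
of the remaining F's yields two geometric sums, both proportional to [n+1]. -/
theorem Echeck_mul_F_pow (ς : Qq) (n : ℕ) : Echeck ς * F ^ (n + 1) =
    q ^ (2 * (n + 1)) • (F ^ (n + 1) * Echeck ς) +
      (qInt (n + 1) * (ς * q ^ (n + 2) / (q - q⁻¹))) • (F ^ n * (1 - q ^ (2 * n) • Ki2)) := by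
  have hq := q_ne_zero
  have hq' := q_sub_inv_ne_zero
  induction n with
  | zero =>
    have : qInt 1 = 1 := by simp [qInt, q_sub_inv_ne_zero]
    simp [Echeck_mul_F, this]
  | succ n ih =>
    rw [pow_succ F (n + 1), ← mul_assoc, ih, add_mul, smul_mul_assoc, smul_mul_assoc, mul_assoc,
      Echeck_mul_F, mul_assoc, sub_mul, one_mul, smul_mul_assoc]
    have h1 : Ki2 * F = q ^ 4 • (F * Ki2) := by simpa using Ki2_mul_F_pow 1
    rw [h1]
    simp only [mul_add, mul_sub, mul_smul_comm, mul_one, ← mul_assoc, ← pow_succ]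
    match_scalars
    · ring
    · simp only [qInt, zpow_neg]
      simp only [zpow_add₀ hq, zpow_natCast, zpow_ofNat]
      field_simp
      ring
    · simp only [qInt, zpow_neg]
      simp only [zpow_add₀ hq, zpow_natCast, zpow_ofNat]
      field_simp
      ring

theorem Echeck_mul_extZ (ς : Qq) (a : ℤ) : Echeck ς * extZ (divPow F) a =
    q ^ (2 * a) • (extZ (divPow F) a * Echeck ς) +
      (ς * q ^ (a + 1) / (q - q⁻¹)) •
        (extZ (divPow F) (a - 1) * (1 - q ^ (2 * a - 2) • Ki2)) := by
  rcases lt_trichotomy a 0 with h | rfl | h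
  · simp [extZ_of_neg _ h, extZ_of_neg _ (show a - 1 < 0 by omega)]
  · rw [extZ_of_neg _ (show (0 : ℤ) - 1 < 0 by omega)]
    have : extZ (divPow F) 0 = 1 := by simp [extZ, divPow, qFact]
    simp [this]
  · obtain ⟨n, rfl⟩ : ∃ n : ℕ, a = (n : ℤ) + 1 := ⟨(a - 1).toNat, by omega⟩
    have h1 := qFact_ne_zero n
    have h2 : qInt ((n : ℤ) + 1) ≠ 0 := by exact_mod_cast qInt_ne_zero n.succ_ne_zero
    rw [add_sub_cancel_right, extZ_natCast, ← Nat.cast_succ, extZ_natCast, divPow, divPow,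
      mul_smul_comm, Echeck_mul_F_pow, qFact_succ, smul_mul_assoc, smul_mul_assoc,
      show (2 * ((n.succ : ℕ) : ℤ) - 2) = ((2 * n : ℕ) : ℤ) by push_cast; ring,
      show ((n.succ : ℕ) : ℤ) + 1 = ((n + 2 : ℕ) : ℤ) by push_cast; ring,
      show (2 * ((n.succ : ℕ) : ℤ)) = ((2 * (n + 1) : ℕ) : ℤ) by push_cast; ring]
    simp only [zpow_natCast]
    match_scalars
    · ring
    · field_simp

theorem Echeck_mul_Kinv (ς : Qq) :
    Echeck ς * ((K⁻¹ : Uˣ) : U) = q ^ 2 • (((K⁻¹ : Uˣ) : U) * Echeck ς) := by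
  rw [Echeck, smul_mul_assoc, E_mul_Kinv, smul_mul_assoc, mul_smul_comm, mul_assoc, E_mul_Kinv,
    mul_smul_comm]
  module

theorem Echeck_mul_Ki2 (ς : Qq) : Echeck ς * Ki2 = q ^ 4 • (Ki2 * Echeck ς) := by
  rw [Ki2_eq, ← mul_assoc, Echeck_mul_Kinv, smul_mul_assoc, mul_assoc, Echeck_mul_Kinv,
    mul_smul_comm, smul_smul, mul_assoc]
  congr 1
  ring

theorem Echeck_mul_K (ς : Qq) : Echeck ς * (K : U) = (q ^ 2)⁻¹ • ((K : U) * Echeck ς) := by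
  have h : q ^ 2 ≠ 0 := pow_ne_zero _ q_ne_zero
  rw [Echeck, smul_mul_assoc, mul_smul_comm, mul_assoc, Units.inv_mul, mul_one, ← mul_assoc,
    K_mul_E, smul_mul_assoc, mul_assoc, Units.mul_inv, mul_one, smul_comm, inv_smul_smul₀ h]

theorem Echeck_mul_zpow (ς : Qq) (s : ℤ) : Echeck ς * ((K ^ s : Uˣ) : U) =
    q ^ (-2 * s) • (((K ^ s : Uˣ) : U) * Echeck ς) := by
  have hq := q_ne_zero
  have h2 : Echeck ς * (K : U) = q ^ (-2 : ℤ) • ((K : U) * Echeck ς) := Echeck_mul_K ς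
  have h3 := Echeck_mul_Kinv ς
  induction s using Int.induction_on with
  | zero => simp
  | succ n ih =>
    rw [zpow_add_one, Units.val_mul, ← mul_assoc, ih, smul_mul_assoc, mul_assoc, h2,
      mul_smul_comm, smul_smul, ← zpow_add₀ hq, mul_assoc]
    congr 2
    ring
  | pred n ih =>
    rw [zpow_sub_one, Units.val_mul, ← mul_assoc, ih, smul_mul_assoc, mul_assoc, h3,
      mul_smul_comm, smul_smul, ← zpow_natCast, ← zpow_add₀ hq, mul_assoc]
    congr 2
    push_cast
    ring

theorem Commute_Ki2_zpow (s : ℤ) : Commute Ki2 ((K ^ s : Uˣ) : U) := by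
  rw [Ki2, Commute, SemiconjBy, ← Units.val_mul, ← Units.val_mul, ← zpow_add, ← zpow_add, add_comm]

/-! ### Cartan binomials -/

theorem hBinom_succ (a : ℤ) (n : ℕ) : hBinom a (n + 1) = hBinom a n *
    ((q ^ (4 * ((n : ℤ) + 1)) - 1)⁻¹ • (q ^ (4 * a + 4 * n) • Ki2 - 1)) := by
  rw [hBinom, List.range_succ, List.map_append, List.prod_append, ← hBinom, List.map_singleton,
    List.prod_singleton]
  rw [show 4 * a + 4 * ((n : ℤ) + 1) - 4 = 4 * a + 4 * n by ring]
  rfl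

theorem Commute_hBinom {y : U} (h : Commute Ki2 y) (a : ℤ) (n : ℕ) : Commute (hBinom a n) y := by
  induction n with
  | zero => simp [hBinom]
  | succ n ih =>
    rw [hBinom_succ]
    exact ih.mul_left ((((h.smul_left _).sub_left (Commute.one_left y))).smul_left _)

theorem Echeck_mul_hBinom (ς : Qq) (a : ℤ) (n : ℕ) :
    Echeck ς * hBinom a n = hBinom (a + 1) n * Echeck ς := by
  induction n with
  | zero => simp [hBinom]
  | succ n ih =>
    rw [hBinom_succ, ← mul_assoc, ih, hBinom_succ, mul_assoc, mul_assoc]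
    congr 1
    rw [mul_smul_comm, smul_mul_assoc, mul_sub, sub_mul, mul_smul_comm, Echeck_mul_Ki2, smul_smul,
      smul_mul_assoc, mul_one, one_mul, ← zpow_natCast, ← zpow_add₀ q_ne_zero]
    congr 4
    push_cast
    ring

theorem q_zpow_sub_one_ne_zero (n : ℕ) : q ^ (4 * ((n : ℤ) + 1)) - 1 ≠ 0 := by
  rw [sub_ne_zero, show (4 * ((n : ℤ) + 1)) = ((4 * (n + 1) : ℕ) : ℤ) by push_cast; ring,
    zpow_natCast]
  exact q_pow_ne_one (by omega)

theorem smul_hBinom_succ (a : ℤ) (n : ℕ) : (q ^ (4 * ((n : ℤ) + 1)) - 1) • hBinom a (n + 1) =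
    hBinom a n * (q ^ (4 * a + 4 * n) • Ki2 - 1) := by
  rw [hBinom_succ, mul_smul_comm, smul_inv_smul₀ (q_zpow_sub_one_ne_zero n)]

/-- Here the first numerator is split off instead of the last: the remaining numerators are those of
the binomial with a raised by one. -/
theorem smul_hBinom_succ' (a : ℤ) (n : ℕ) : (q ^ (4 * ((n : ℤ) + 1)) - 1) • hBinom a (n + 1) =
    (q ^ (4 * a) • Ki2 - 1) * hBinom (a + 1) n := by
  induction n with
  | zero => rw [smul_hBinom_succ]; simp [hBinom]
  | succ n ih =>
    rw [smul_hBinom_succ, hBinom_succ (a + 1) n, ← mul_assoc, ← ih, smul_mul_assoc, mul_smul_comm,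
      smul_inv_smul₀ (q_zpow_sub_one_ne_zero n)]
    rw [show 4 * a + 4 * ((n + 1 : ℕ) : ℤ) = 4 * (a + 1) + 4 * n by push_cast; ring]

/-- Integer-indexed Cartan binomials. -/
def hBinomZ (a : ℤ) (c : ℤ) : U := extZ (hBinom a) c

theorem hBinomZ_sub_one (a c : ℤ) : hBinomZ (a + 1) (c - 1) =
    q ^ (4 * a) • (Ki2 * hBinomZ (a + 1) (c - 1)) - (q ^ (4 * c) - 1) • hBinomZ a c := by
  rcases lt_trichotomy c 0 with h | rfl | h
  · simp [hBinomZ, extZ_of_neg _ h, extZ_of_neg _ (show c - 1 < 0 by omega)]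
  · simp [hBinomZ, extZ_of_neg _ (show (-1 : ℤ) < 0 by omega)]
  · obtain ⟨n, rfl⟩ : ∃ n : ℕ, c = (n : ℤ) + 1 := ⟨(c - 1).toNat, by omega⟩
    have h := smul_hBinom_succ' a n
    rw [add_sub_cancel_right, hBinomZ, hBinomZ, extZ_natCast, ← Nat.cast_succ, extZ_natCast]
    push_cast
    rw [h, sub_mul, smul_mul_assoc, one_mul]
    abel

/-- A q-Pascal rule, obtained by splitting off the last numerator on the left and the first one on
the right. Together with `hBinomZ_sub_one` it reduces every Cartan part in the recursion to two. -/
theorem hBinomZ_add_one (a c : ℤ) : hBinomZ (a + 1) c =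
    hBinomZ a c + q ^ (4 * a) • (Ki2 * hBinomZ (a + 1) (c - 1)) := by
  rcases lt_trichotomy c 0 with h | rfl | h
  · simp [hBinomZ, extZ_of_neg _ h, extZ_of_neg _ (show c - 1 < 0 by omega)]
  · simp [hBinomZ, extZ, hBinom]
  · obtain ⟨n, rfl⟩ : ∃ n : ℕ, c = (n : ℤ) + 1 := ⟨(c - 1).toNat, by omega⟩
    have h := smul_hBinom_succ' a n
    have h' := smul_hBinom_succ (a + 1) n
    rw [add_sub_cancel_right, hBinomZ, hBinomZ, hBinomZ, extZ_natCast, ← Nat.cast_succ,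
      extZ_natCast, extZ_natCast]
    refine smul_right_injective U (q_zpow_sub_one_ne_zero n) ?_
    simp only [smul_add]
    rw [h, h', (Commute_hBinom (Commute.refl Ki2) (a + 1) n |>.smul_right _ |>.sub_right
      (Commute.one_right _)).eq, sub_mul, sub_mul, smul_mul_assoc, smul_mul_assoc,
      show 4 * (a + 1) + 4 * (n : ℤ) = 4 * a + 4 * ((n : ℤ) + 1) by ring, zpow_add₀ q_ne_zero]
    module

theorem Echeck_mul_hBinomZ (ς : Qq) (a c : ℤ) :
    Echeck ς * hBinomZ a c = hBinomZ (a + 1) c * Echeck ς := by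
  rcases lt_or_ge c 0 with h | h
  · simp [hBinomZ, extZ_of_neg _ h]
  · lift c to ℕ using h
    rw [hBinomZ, hBinomZ, extZ_natCast, extZ_natCast, Echeck_mul_hBinom]

theorem Commute_hBinomZ (a c s : ℤ) : Commute (hBinomZ a c) ((K ^ s : Uˣ) : U) := by
  rcases lt_or_ge c 0 with h | h
  · simp [hBinomZ, extZ_of_neg _ h]
  · lift c to ℕ using h
    rw [hBinomZ, extZ_natCast]
    exact Commute_hBinom (Commute_Ki2_zpow s) _ _

/-! ### Recursion for the even ı-divided powers -/

theorem range_prod_succ_left (f : ℕ → U) (k : ℕ) :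
    ((List.range (k + 1)).map f).prod = f 0 * ((List.range k).map fun i => f (i + 1)).prod := by
  rw [List.range_succ_eq_map, List.map_cons, List.prod_cons, List.map_map]
  rfl

theorem range_prod_succ_right (f : ℕ → U) (k : ℕ) :
    ((List.range (k + 1)).map f).prod = ((List.range k).map f).prod * f k := by
  simp [List.range_succ]

/-- The product `∏_{j=1}^k (B² - qς [2j]²)`. -/
def oddProd (ς : Qq) (k : ℕ) : U :=
  ((List.range k).map fun i : ℕ =>
    B ς ^ 2 - algebraMap Qq U (q * ς * qInt (2 * ((i : ℤ) + 1)) ^ 2)).prod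

theorem Bev_odd (ς : Qq) (k : ℕ) :
    Bev ς (2 * k + 1) = (qFact (2 * k + 1))⁻¹ • (B ς * oddProd ς k) := by
  rw [Bev, if_pos (by simp), oddProd, show (2 * k + 1) / 2 = k by omega]

/-- The factor with j = 1 is B² because [0] = 0, and the others are those of the odd case, so one
product serves both parities. -/
theorem Bev_even (ς : Qq) (k : ℕ) :
    Bev ς (2 * k + 2) = (qFact (2 * k + 2))⁻¹ • (B ς ^ 2 * oddProd ς k) := by
  rw [Bev, if_neg (by simp [parity_simps]), oddProd, show (2 * k + 2) / 2 = k + 1 by omega,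
    range_prod_succ_left]
  congr 2
  · simp [qInt_zero]
  · congr 2
    funext i
    congr 5
    push_cast
    ring

theorem Bev_zero (ς : Qq) : Bev ς 0 = 1 := by simp [Bev, qFact]

theorem oddProd_succ (ς : Qq) (k : ℕ) : B ς * oddProd ς (k + 1) =
    B ς * (B ς ^ 2 * oddProd ς k) - (q * ς * qInt (2 * k + 2) ^ 2) • (B ς * oddProd ς k) := by
  have h : Commute (oddProd ς k) (B ς ^ 2) := by
    induction k with
    | zero => simp [oddProd]
    | succ k ih =>
      rw [oddProd, range_prod_succ_right, ← oddProd]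
      exact ih.mul_left ((Commute.refl _).sub_left (Algebra.commutes _ _))
  rw [oddProd, range_prod_succ_right, ← oddProd, mul_sub, ← Algebra.commutes, h.eq, mul_sub,
    ← Algebra.smul_def, mul_smul_comm]
  congr 5

theorem B_mul_Bev_odd (ς : Qq) (k : ℕ) :
    B ς * Bev ς (2 * k + 1) = qInt (2 * k + 2) • Bev ς (2 * k + 2) := by
  have h : qInt ((2 * k + 1 : ℕ) + 1) ≠ 0 := by exact_mod_cast qInt_ne_zero (2 * k + 1).succ_ne_zero
  have h' := qFact_ne_zero (2 * k + 1)
  rw [Bev_odd, Bev_even, mul_smul_comm, qFact_succ (2 * k + 1), smul_smul, ← mul_assoc, ← pow_two,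
    show 2 * (k : ℤ) + 2 = (2 * k + 1 : ℕ) + 1 by push_cast; ring]
  congr 1
  field_simp

/-- Write B² as the next factor B² - qς[2k+2]² plus qς[2k+2]²; one power of [2k+2] in the correction
cancels against [2k+2]!. -/
theorem B_mul_Bev_even (ς : Qq) (k : ℕ) :
    B ς * Bev ς (2 * k + 2) = qInt (2 * k + 3) • Bev ς (2 * k + 3) +
      (q * ς * qInt (2 * k + 2)) • Bev ς (2 * k + 1) := by
  have h : qInt ((2 * k + 1 : ℕ) + 1) ≠ 0 := by exact_mod_cast qInt_ne_zero (2 * k + 1).succ_ne_zero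
  have h2 : qInt ((2 * k + 2 : ℕ) + 1) ≠ 0 := by exact_mod_cast qInt_ne_zero (2 * k + 2).succ_ne_zero
  have h' := qFact_ne_zero (2 * k + 1)
  have e : (2 * (k : ℤ) + 3) = (2 * k + 2 : ℕ) + 1 := by push_cast; ring
  have e' : (2 * (k : ℤ) + 2) = (2 * k + 1 : ℕ) + 1 := by push_cast; ring
  rw [show 2 * k + 3 = 2 * (k + 1) + 1 by ring, Bev_odd, Bev_odd, Bev_even, oddProd_succ, e, e',
    show 2 * (k + 1) + 1 = 2 * k + 2 + 1 by ring, qFact_succ (2 * k + 2),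
    qFact_succ (2 * k + 1), mul_smul_comm]
  push_cast at h h2
  generalize B ς * (B ς ^ 2 * oddProd ς k) = u
  generalize B ς * oddProd ς k = v
  match_scalars
  · field_simp
  · field_simp
    ring

theorem B_mul_extZ_Bev (ς : Qq) (m : ℤ) : B ς * extZ (Bev ς) m =
    qInt (m + 1) • extZ (Bev ς) (m + 1) +
      (if Even m then q * ς * qInt m else 0) • extZ (Bev ς) (m - 1) := by
  rcases lt_trichotomy m 0 with h | rfl | h
  · rw [extZ_of_neg _ h, extZ_of_neg _ (show m - 1 < 0 by omega), mul_zero, smul_zero, add_zero]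
    rcases eq_or_ne m (-1) with rfl | h1
    · simp [qInt_zero]
    · rw [extZ_of_neg _ (by omega), smul_zero]
  · have h1 : qInt 1 = 1 := by simp [qInt, q_sub_inv_ne_zero]
    simp [extZ, Bev_zero, qInt_zero, h1]
    simp [Bev, qFact, h1]
  · obtain ⟨k, rfl | rfl⟩ : ∃ k : ℕ, m = (2 * k + 1 : ℕ) ∨ m = (2 * k + 2 : ℕ) :=
      ⟨((m - 1) / 2).toNat, by omega⟩
    · rw [if_neg (by simp [parity_simps]), zero_smul, add_zero, extZ_natCast, B_mul_Bev_odd,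
        show ((2 * k + 1 : ℕ) : ℤ) + 1 = (2 * k + 2 : ℕ) by push_cast; ring, extZ_natCast]
      push_cast
      rfl
    · rw [if_pos (by simp [parity_simps]), extZ_natCast, B_mul_Bev_even,
        show ((2 * k + 2 : ℕ) : ℤ) + 1 = (2 * k + 3 : ℕ) by push_cast; ring,
        show ((2 * k + 2 : ℕ) : ℤ) - 1 = (2 * k + 1 : ℕ) by push_cast; ring, extZ_natCast,
        extZ_natCast]
      push_cast
      rfl

/-! ### Triangular monomials -/

theorem Units_zpow_neg_one : ((K⁻¹ : Uˣ) : U) = ((K ^ (-1 : ℤ) : Uˣ) : U) := by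
  rw [zpow_neg_one]

/-- The triangular monomial `F^(a) u K^s Ě^(b)`. -/
def triMon (ς : Qq) (a : ℤ) (u : U) (s b : ℤ) : U :=
  extZ (divPow F) a * u * ((K ^ s : Uˣ) : U) * extZ (divPow (Echeck ς)) b

theorem Kinv_mul_triMon (ς : Qq) (a : ℤ) {u : U} (s b : ℤ)
    (hu : ∀ s : ℤ, Commute u ((K ^ s : Uˣ) : U)) :
    ((K⁻¹ : Uˣ) : U) * triMon ς a u s b = q ^ (2 * a) • triMon ς a u (s - 1) b := by
  have h : ((K⁻¹ : Uˣ) : U) * u = u * ((K⁻¹ : Uˣ) : U) := by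
    rw [Units_zpow_neg_one]; exact (hu (-1)).eq.symm
  rw [triMon, triMon, ← mul_assoc, ← mul_assoc, ← mul_assoc, Kinv_mul_extZ, smul_mul_assoc,
    smul_mul_assoc, smul_mul_assoc, mul_assoc _ _ u, h, ← mul_assoc, mul_assoc _ ((K⁻¹ : Uˣ) : U),
    ← Units.val_mul, ← zpow_neg_one, ← zpow_add, show -1 + s = s - 1 by ring]

theorem F_mul_triMon (ς : Qq) (a : ℤ) (u : U) (s b : ℤ) :
    F * triMon ς a u s b = qInt (a + 1) • triMon ς (a + 1) u s b := by
  rw [triMon, triMon, ← mul_assoc, ← mul_assoc, ← mul_assoc, mul_extZ_divPow, smul_mul_assoc,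
    smul_mul_assoc, smul_mul_assoc]

theorem Echeck_mul_triMon (ς : Qq) (a α c s b : ℤ) : Echeck ς * triMon ς a (hBinomZ α c) s b =
    (q ^ (2 * a) * q ^ (-2 * s) * qInt (b + 1)) • triMon ς a (hBinomZ (α + 1) c) s (b + 1) +
    (ς * q ^ (a + 1) / (q - q⁻¹)) •
      triMon ς (a - 1) ((1 - q ^ (2 * a - 2) • Ki2) * hBinomZ α c) s b := by
  have h1 : Echeck ς * (hBinomZ α c * (((K ^ s : Uˣ) : U) * extZ (divPow (Echeck ς)) b)) =
      (q ^ (-2 * s) * qInt (b + 1)) •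
        (hBinomZ (α + 1) c * (((K ^ s : Uˣ) : U) * extZ (divPow (Echeck ς)) (b + 1))) := by
    rw [← mul_assoc, Echeck_mul_hBinomZ, mul_assoc, ← mul_assoc (Echeck ς), Echeck_mul_zpow,
      smul_mul_assoc, mul_assoc, mul_extZ_divPow, mul_smul_comm, mul_smul_comm, mul_smul_comm,
      smul_smul]
  simp only [triMon, mul_assoc]
  rw [← mul_assoc (Echeck ς), Echeck_mul_extZ, add_mul, smul_mul_assoc, mul_assoc, h1,
    mul_smul_comm, smul_smul, smul_mul_assoc]
  simp only [mul_assoc]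

theorem triMon_add (ς : Qq) (a : ℤ) (u v : U) (s b : ℤ) :
    triMon ς a (u + v) s b = triMon ς a u s b + triMon ς a v s b := by
  simp only [triMon, mul_add, add_mul]

theorem triMon_sub (ς : Qq) (a : ℤ) (u v : U) (s b : ℤ) :
    triMon ς a (u - v) s b = triMon ς a u s b - triMon ς a v s b := by
  simp only [triMon, mul_sub, sub_mul]

theorem triMon_smul (ς : Qq) (a : ℤ) (t : Qq) (u : U) (s b : ℤ) :
    triMon ς a (t • u) s b = t • triMon ς a u s b := by
  simp only [triMon, mul_smul_comm, smul_mul_assoc]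

/-- Absorbing K⁻² into the Cartan part lets all terms of the recursion carry the same power of K. -/
theorem triMon_sub_two (ς : Qq) (a : ℤ) {u : U} (s b : ℤ) (hu : Commute Ki2 u) :
    triMon ς a u (s - 2) b = triMon ς a (Ki2 * u) s b := by
  rw [triMon, triMon, hu.eq, show s - 2 = -2 + s by ring, zpow_add, Units.val_mul, ← Ki2]
  simp only [mul_assoc]

theorem triMon_of_neg_left (ς : Qq) {a : ℤ} (ha : a < 0) (u : U) (s b : ℤ) :
    triMon ς a u s b = 0 := by simp [triMon, extZ_of_neg _ ha]

theorem triMon_of_neg_right (ς : Qq) {b : ℤ} (hb : b < 0) (a : ℤ) (u : U) (s : ℤ) :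
    triMon ς a u s b = 0 := by simp [triMon, extZ_of_neg _ hb]

/-! ### Right tensor factors and their scalar weights -/

/-- The shift in the Cartan binomials. -/
def shiftIdx (n m : ℤ) : ℤ := if Even n then m / 2 else (m + 1) / 2

/-- The scalar coefficients in the comultiplication formula. -/
def wt (ς : Qq) (n a b c : ℤ) : Qq :=
  (-(q * ς)) ^ c * q ^ ((if Even n then 3 else 1) * c - (a + b) * (a + b + 2 * c - n) + a * b)

/-- The summands of the right tensor factors. -/
def summand (ς : Qq) (n a b c : ℤ) : U :=
  wt ς n a b c • triMon ς a (hBinomZ (shiftIdx n (a + b)) c) (a + b + 2 * c - n) b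

theorem wt_a {ς : Qq} (n a b c : ℤ) :
    wt ς n (a - 1) b c = wt ς n a b c * q ^ (2 * a + b + 2 * c - n - 1) := by
  rw [wt, wt, mul_assoc, ← zpow_add₀ q_ne_zero]
  congr 2
  ring

theorem wt_b {ς : Qq} (n a b c : ℤ) :
    wt ς n a (b - 1) c = wt ς n a b c * q ^ (a + 2 * b + 2 * c - n - 1) := by
  rw [wt, wt, mul_assoc, ← zpow_add₀ q_ne_zero]
  congr 2
  ring

/-- Integer exponents on -qς make the weight ratio uniform in c, at the price of ς ≠ 0. -/
theorem wt_c {ς : Qq} (hς : ς ≠ 0) (n a b c : ℤ) :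
    wt ς n a b (c - 1) = wt ς n a b c * ((-(q * ς))⁻¹ *
      q ^ (2 * (a + b) - (if Even n then 3 else 1))) := by
  rw [wt, wt, zpow_sub_one₀ (neg_ne_zero.2 (mul_ne_zero q_ne_zero hς)), mul_mul_mul_comm,
    ← zpow_add₀ q_ne_zero]
  congr 2
  ring

theorem wt_ac {ς : Qq} (hς : ς ≠ 0) (n a b c : ℤ) :
    wt ς n (a + 1) b (c - 1) = wt ς n a b c * ((-(q * ς))⁻¹ *
      q ^ (b - 2 * c + n + 1 - (if Even n then 3 else 1))) := by
  rw [wt, wt, zpow_sub_one₀ (neg_ne_zero.2 (mul_ne_zero q_ne_zero hς)), mul_mul_mul_comm,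
    ← zpow_add₀ q_ne_zero]
  congr 2
  ring

theorem wt_succ_of_odd {ς : Qq} {n : ℤ} (hn : ¬ Even n) (a b c : ℤ) :
    wt ς (n + 1) a b c = wt ς n a b c * q ^ (2 * c + a + b) := by
  rw [wt, wt, mul_assoc, ← zpow_add₀ q_ne_zero, if_neg hn, if_pos (by grind)]
  congr 2
  ring

theorem wt_succ_of_even {ς : Qq} {n : ℤ} (hn : Even n) (a b c : ℤ) :
    wt ς (n + 1) a b c = wt ς n a b c * q ^ (a + b - 2 * c) := by
  rw [wt, wt, mul_assoc, ← zpow_add₀ q_ne_zero, if_pos hn, if_neg (by grind)]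
  congr 2
  ring

theorem wt_pred_of_even {ς : Qq} (hς : ς ≠ 0) {n : ℤ} (hn : Even n) (a b c : ℤ) :
    wt ς (n - 1) a b (c - 1) = wt ς n a b c * ((-(q * ς))⁻¹ * q ^ (a + b - 2 * c - 1)) := by
  rw [wt, wt, zpow_sub_one₀ (neg_ne_zero.2 (mul_ne_zero q_ne_zero hς)), mul_mul_mul_comm,
    ← zpow_add₀ q_ne_zero, if_pos hn, if_neg (by grind)]
  congr 2
  ring

theorem Commute_Ki2_hBinomZ (a c : ℤ) : Commute Ki2 (hBinomZ a c) := (Commute_hBinomZ a c (-2)).symm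

/-! ### Products with K⁻¹, F and Ě, normalised to a common monomial shape -/

/-- The part of `Ě * summand ς n a b c` in which `Ě` has passed `F^(a)`. -/
def EchPass (ς : Qq) (n a b c : ℤ) : U :=
  (wt ς n a b c * (q ^ (2 * a) * q ^ (-2 * (a + b + 2 * c - n)) * qInt (b + 1))) •
    triMon ς a (hBinomZ (shiftIdx n (a + b) + 1) c) (a + b + 2 * c - n) (b + 1)

/-- The part of `Ě * summand ς n a b c` coming from the commutator of `Ě` and `F^(a)`. -/
def EchComm (ς : Qq) (n a b c : ℤ) : U :=
  (wt ς n a b c * (ς * q ^ (a + 1) / (q - q⁻¹))) •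
    triMon ς (a - 1) ((1 - q ^ (2 * a - 2) • Ki2) * hBinomZ (shiftIdx n (a + b)) c)
      (a + b + 2 * c - n) b

theorem Echeck_mul_summand (ς : Qq) (n a b c : ℤ) :
    Echeck ς * summand ς n a b c = EchPass ς n a b c + EchComm ς n a b c := by
  rw [summand, mul_smul_comm, Echeck_mul_triMon, EchPass, EchComm, smul_add, smul_smul, smul_smul]

theorem Kinv_mul_summand (ς : Qq) (n a b c : ℤ) : ((K⁻¹ : Uˣ) : U) * summand ς n a b c =
    (wt ς n a b c * q ^ (2 * a)) •
      triMon ς a (hBinomZ (shiftIdx n (a + b)) c) (a + b + 2 * c - n - 1) b := by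
  rw [summand, mul_smul_comm, Kinv_mul_triMon _ _ _ _ (Commute_hBinomZ _ _), smul_smul]

theorem Kinv_mul_summand_pred (ς : Qq) (n a b c : ℤ) :
    ((K⁻¹ : Uˣ) : U) * summand ς n a b (c - 1) = (wt ς n a b (c - 1) * q ^ (2 * a)) •
      triMon ς a (Ki2 * hBinomZ (shiftIdx n (a + b)) (c - 1)) (a + b + 2 * c - n - 1) b := by
  rw [Kinv_mul_summand, ← triMon_sub_two _ _ _ _ (Commute_Ki2_hBinomZ _ _)]
  congr 2
  ring

theorem F_mul_summand_pred (ς : Qq) (n a b c : ℤ) : F * summand ς n (a - 1) b c =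
    (wt ς n (a - 1) b c * qInt a) •
      triMon ς a (hBinomZ (shiftIdx n (a + b - 1)) c) (a + b + 2 * c - n - 1) b := by
  rw [summand, mul_smul_comm, F_mul_triMon, smul_smul, sub_add_cancel,
    show a - 1 + b = a + b - 1 by ring,
    show a + b - 1 + 2 * c - n = a + b + 2 * c - n - 1 by ring]

theorem EchPass_pred (ς : Qq) (n a b c : ℤ) : EchPass ς n a (b - 1) c =
    (wt ς n a (b - 1) c * (q ^ (2 * a) * q ^ (-2 * (a + b + 2 * c - n - 1)) * qInt b)) •
      triMon ς a (hBinomZ (shiftIdx n (a + b - 1) + 1) c) (a + b + 2 * c - n - 1) b := by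
  rw [EchPass, sub_add_cancel, show a + (b - 1) = a + b - 1 by ring,
    show a + b - 1 + 2 * c - n = a + b + 2 * c - n - 1 by ring]

theorem EchComm_succ (ς : Qq) (n a b c : ℤ) : EchComm ς n (a + 1) b (c - 1) =
    (wt ς n (a + 1) b (c - 1) * (ς * q ^ (a + 2) / (q - q⁻¹))) •
      (triMon ς a (hBinomZ (shiftIdx n (a + b + 1)) (c - 1)) (a + b + 2 * c - n - 1) b -
        q ^ (2 * a) • triMon ς a (Ki2 * hBinomZ (shiftIdx n (a + b + 1)) (c - 1))
          (a + b + 2 * c - n - 1) b) := by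
  rw [EchComm, add_sub_cancel_right, show a + 1 + b = a + b + 1 by ring,
    show a + b + 1 + 2 * (c - 1) - n = a + b + 2 * c - n - 1 by ring,
    show 2 * (a + 1) - 2 = 2 * a by ring, show a + 1 + 1 = a + 2 by ring, sub_mul, one_mul,
    smul_mul_assoc, triMon_sub, triMon_smul]

theorem summand_succ (ς : Qq) (n a b c : ℤ) : summand ς (n + 1) a b c = wt ς (n + 1) a b c •
    triMon ς a (hBinomZ (shiftIdx (n + 1) (a + b)) c) (a + b + 2 * c - n - 1) b := by
  rw [summand, show a + b + 2 * c - (n + 1) = a + b + 2 * c - n - 1 by ring]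

theorem summand_pred_pred (ς : Qq) (n a b c : ℤ) : summand ς (n - 1) a b (c - 1) =
    wt ς (n - 1) a b (c - 1) •
      triMon ς a (hBinomZ (shiftIdx (n - 1) (a + b)) (c - 1)) (a + b + 2 * c - n - 1) b := by
  rw [summand, show a + b + 2 * (c - 1) - (n - 1) = a + b + 2 * c - n - 1 by ring]

/-! ### The recursion for right factors -/

theorem triMon_add_one (ς : Qq) (α c a s b : ℤ) : triMon ς a (hBinomZ (α + 1) c) s b =
    triMon ς a (hBinomZ α c) s b +
      (q ^ α) ^ 4 • triMon ς a (Ki2 * hBinomZ (α + 1) (c - 1)) s b := by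
  rw [hBinomZ_add_one, triMon_add, triMon_smul, zpow_mul']
  rfl

theorem triMon_sub_one (ς : Qq) (α c a s b : ℤ) : triMon ς a (hBinomZ (α + 1) (c - 1)) s b =
    (q ^ α) ^ 4 • triMon ς a (Ki2 * hBinomZ (α + 1) (c - 1)) s b -
      ((q ^ c) ^ 4 - 1) • triMon ς a (hBinomZ α c) s b := by
  conv_lhs => rw [hBinomZ_sub_one, triMon_sub, triMon_smul, triMon_smul, zpow_mul', zpow_mul']
  rfl

theorem summand_recursion_of_odd {ς : Qq} (hς : ς ≠ 0) {n : ℤ} (hn : ¬ Even n) (a b c : ℤ) :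
    qInt (n + 1) • summand ς (n + 1) a b c =
      qInt (n + 1 - a - b - 2 * c) • (((K⁻¹ : Uˣ) : U) * summand ς n a b c) +
      (if Even (n - a - b) then q * ς * qInt (n + 2 - a - b - 2 * c) else 0) •
        (((K⁻¹ : Uˣ) : U) * summand ς n a b (c - 1)) +
      F * summand ς n (a - 1) b c + EchPass ς n a (b - 1) c + EchComm ς n (a + 1) b (c - 1) := by
  have hq := q_ne_zero
  have hq' := q_sub_inv_ne_zero
  rw [summand_succ, Kinv_mul_summand, Kinv_mul_summand_pred, F_mul_summand_pred, EchPass_pred,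
    EchComm_succ, wt_succ_of_odd hn, wt_a, wt_b, wt_c hς, wt_ac hς, if_neg hn]
  generalize wt ς n a b c = w
  generalize hs : a + b + 2 * c - n - 1 = s
  obtain ⟨l, rfl⟩ : ∃ l, n = 2 * l + 1 := by rcases Int.even_or_odd' n with ⟨l, h | h⟩ <;> grind
  simp only [shiftIdx, if_neg hn, if_pos (show Even (2 * l + 1 + 1) by grind)]
  obtain ⟨k, hk | hk⟩ := Int.even_or_odd' (a + b)
  -- The term with K⁻²[h; k; c-1], which the reduction does not cover, has coefficient zero here
  -- because n - a - b is odd.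
  · obtain rfl : b = 2 * k - a := by omega
    rw [show (a + (2 * k - a)) / 2 = k by omega, show (a + (2 * k - a) + 1) / 2 = k by omega,
      show (a + (2 * k - a) - 1 + 1) / 2 = k by omega,
      show (a + (2 * k - a) + 1 + 1) / 2 = k + 1 by omega, if_neg (by grind), triMon_add_one,
      triMon_sub_one]
    generalize triMon ς a (hBinomZ k c) s (2 * k - a) = G
    generalize triMon ς a (Ki2 * hBinomZ (k + 1) (c - 1)) s (2 * k - a) = Z
    simp only [zero_smul, add_zero]
    match_scalars
    -- The two goals compare the coefficients of `G` and `Z`. Once s is eliminated, the powers of q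
    -- with variable exponent become independent nonzero quantities A, P, L, C.
    all_goals
      obtain rfl : s = 2 * k + 2 * c - 2 * l - 2 := by omega
      simp only [qInt, neg_add, neg_sub, neg_mul, mul_add, mul_sub, mul_neg, zpow_add₀ hq,
        zpow_sub₀ hq, zpow_neg, zpow_mul', zpow_ofNat]
      generalize hA : q ^ a = A
      have hA0 : A ≠ 0 := hA ▸ zpow_ne_zero _ hq
      generalize hP : q ^ k = P
      have hP0 : P ≠ 0 := hP ▸ zpow_ne_zero _ hq
      generalize hL : q ^ l = L
      have hL0 : L ≠ 0 := hL ▸ zpow_ne_zero _ hq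
      generalize hC : q ^ c = C
      have hC0 : C ≠ 0 := hC ▸ zpow_ne_zero _ hq
      field_simp
      ring
  · obtain rfl : b = 2 * k + 1 - a := by omega
    rw [show (a + (2 * k + 1 - a)) / 2 = k by omega,
      show (a + (2 * k + 1 - a) + 1) / 2 = k + 1 by omega,
      show (a + (2 * k + 1 - a) - 1 + 1) / 2 = k by omega,
      show (a + (2 * k + 1 - a) + 1 + 1) / 2 = k + 1 by omega, if_pos (by grind), triMon_add_one,
      triMon_sub_one]
    generalize triMon ς a (hBinomZ k c) s (2 * k + 1 - a) = G
    generalize triMon ς a (Ki2 * hBinomZ (k + 1) (c - 1)) s (2 * k + 1 - a) = Z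
    match_scalars
    all_goals
      obtain rfl : s = 2 * k + 2 * c - 2 * l - 1 := by omega
      simp only [qInt, neg_add, neg_sub, neg_mul, mul_add, mul_sub, mul_neg, zpow_add₀ hq,
        zpow_sub₀ hq, zpow_neg, zpow_mul', zpow_ofNat]
      generalize hA : q ^ a = A
      have hA0 : A ≠ 0 := hA ▸ zpow_ne_zero _ hq
      generalize hP : q ^ k = P
      have hP0 : P ≠ 0 := hP ▸ zpow_ne_zero _ hq
      generalize hL : q ^ l = L
      have hL0 : L ≠ 0 := hL ▸ zpow_ne_zero _ hq
      generalize hC : q ^ c = C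
      have hC0 : C ≠ 0 := hC ▸ zpow_ne_zero _ hq
      field_simp
      ring

theorem summand_recursion_of_even {ς : Qq} (hς : ς ≠ 0) {n : ℤ} (hn : Even n) (a b c : ℤ) :
    qInt (n + 1) • summand ς (n + 1) a b c + (q * ς * qInt n) • summand ς (n - 1) a b (c - 1) =
      qInt (n + 1 - a - b - 2 * c) • (((K⁻¹ : Uˣ) : U) * summand ς n a b c) +
      (if Even (n - a - b) then q * ς * qInt (n + 2 - a - b - 2 * c) else 0) •
        (((K⁻¹ : Uˣ) : U) * summand ς n a b (c - 1)) +
      F * summand ς n (a - 1) b c + EchPass ς n a (b - 1) c + EchComm ς n (a + 1) b (c - 1) := by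
  have hq := q_ne_zero
  have hq' := q_sub_inv_ne_zero
  rw [summand_succ, summand_pred_pred, Kinv_mul_summand, Kinv_mul_summand_pred,
    F_mul_summand_pred, EchPass_pred, EchComm_succ, wt_succ_of_even hn, wt_pred_of_even hς hn,
    wt_a, wt_b, wt_c hς, wt_ac hς, if_pos hn]
  generalize wt ς n a b c = w
  generalize hs : a + b + 2 * c - n - 1 = s
  obtain ⟨l, rfl⟩ : ∃ l, n = 2 * l := by rcases Int.even_or_odd' n with ⟨l, h | h⟩ <;> grind
  simp only [shiftIdx, if_pos hn, if_neg (show ¬ Even (2 * l + 1) by grind),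
    if_neg (show ¬ Even (2 * l - 1) by grind)]
  obtain ⟨k, hk | hk⟩ := Int.even_or_odd' (a + b - 1)
  -- Again n - a - b is odd, which removes the term with K⁻²[h; k; c-1].
  · obtain rfl : b = 2 * k + 1 - a := by omega
    rw [show (a + (2 * k + 1 - a)) / 2 = k by omega,
      show (a + (2 * k + 1 - a) + 1) / 2 = k + 1 by omega,
      show (a + (2 * k + 1 - a) - 1) / 2 = k by omega, if_neg (by grind), triMon_add_one,
      triMon_sub_one]
    generalize triMon ς a (hBinomZ k c) s (2 * k + 1 - a) = G
    generalize triMon ς a (Ki2 * hBinomZ (k + 1) (c - 1)) s (2 * k + 1 - a) = Z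
    simp only [zero_smul, add_zero]
    match_scalars
    all_goals
      obtain rfl : s = 2 * k + 2 * c - 2 * l := by omega
      simp only [qInt, neg_add, neg_sub, neg_mul, mul_add, mul_sub, mul_neg, zpow_add₀ hq,
        zpow_sub₀ hq, zpow_neg, zpow_mul', zpow_ofNat]
      generalize hA : q ^ a = A
      have hA0 : A ≠ 0 := hA ▸ zpow_ne_zero _ hq
      generalize hP : q ^ k = P
      have hP0 : P ≠ 0 := hP ▸ zpow_ne_zero _ hq
      generalize hL : q ^ l = L
      have hL0 : L ≠ 0 := hL ▸ zpow_ne_zero _ hq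
      generalize hC : q ^ c = C
      have hC0 : C ≠ 0 := hC ▸ zpow_ne_zero _ hq
      field_simp
      ring
  · obtain rfl : b = 2 * k + 2 - a := by omega
    rw [show (a + (2 * k + 2 - a)) / 2 = k + 1 by omega,
      show (a + (2 * k + 2 - a) + 1) / 2 = k + 1 by omega,
      show (a + (2 * k + 2 - a) - 1) / 2 = k by omega, if_pos (by grind), triMon_add_one,
      triMon_sub_one]
    generalize triMon ς a (hBinomZ k c) s (2 * k + 2 - a) = G
    generalize triMon ς a (Ki2 * hBinomZ (k + 1) (c - 1)) s (2 * k + 2 - a) = Z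
    match_scalars
    all_goals
      obtain rfl : s = 2 * k + 2 * c - 2 * l + 1 := by omega
      simp only [qInt, neg_add, neg_sub, neg_mul, mul_add, mul_sub, mul_neg, zpow_add₀ hq,
        zpow_sub₀ hq, zpow_neg, zpow_mul', zpow_ofNat]
      generalize hA : q ^ a = A
      have hA0 : A ≠ 0 := hA ▸ zpow_ne_zero _ hq
      generalize hP : q ^ k = P
      have hP0 : P ≠ 0 := hP ▸ zpow_ne_zero _ hq
      generalize hL : q ^ l = L
      have hL0 : L ≠ 0 := hL ▸ zpow_ne_zero _ hq
      generalize hC : q ^ c = C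
      have hC0 : C ≠ 0 := hC ▸ zpow_ne_zero _ hq
      field_simp
      ring

/-! ### Summation over ℤ³ and multiplication by Δ(B) -/

theorem comul_Kinv : comul ((K⁻¹ : Uˣ) : U) = ((K⁻¹ : Uˣ) : U) ⊗ₜ[Qq] ((K⁻¹ : Uˣ) : U) := by
  rw [show comul ((K⁻¹ : Uˣ) : U) = _ from comul_mk _]; simp [comulGen]

theorem comul_B (ς : Qq) : comul (B ς) =
    B ς ⊗ₜ[Qq] ((K⁻¹ : Uˣ) : U) + 1 ⊗ₜ[Qq] F + 1 ⊗ₜ[Qq] Echeck ς := by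
  rw [B, map_add, map_smul, map_mul, comul_E, comul_F, comul_Kinv, Echeck]
  simp only [add_mul, Algebra.TensorProduct.tmul_mul_tmul, one_mul, Units.mul_inv, smul_add,
    TensorProduct.add_tmul, TensorProduct.smul_tmul', TensorProduct.tmul_smul]
  abel

/-- The summands of the comultiplication formula. -/
def comulTerm (ς : Qq) (n : ℤ) (p : ℤ × ℤ × ℤ) : U ⊗[Qq] U :=
  extZ (Bev ς) (n - p.1 - p.2.1 - 2 * p.2.2) ⊗ₜ[Qq] summand ς n p.1 p.2.1 p.2.2

/-- The lower bound -1, rather than 0, leaves room for `EchPass`, whose monomial has Ě-exponent b +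
1. -/
theorem hasFiniteSupport_of_bounds {M : Type*} [Zero M] {f : ℤ × ℤ × ℤ → M} (N : ℤ)
    (h : ∀ a b c : ℤ, a < -1 ∨ b < -1 ∨ c < -1 ∨ N < a + b + 2 * c → f (a, b, c) = 0) :
    f.HasFiniteSupport := by
  refine (((Set.finite_Icc (-1) (N + 3)).prod ((Set.finite_Icc (-1) (N + 3)).prod
    (Set.finite_Icc (-1) (N + 3))))).subset ?_
  rintro ⟨a, b, c⟩ hp
  have h1 := mt (h a b c) hp
  simp only [Set.mem_prod, Set.mem_Icc]
  omega

theorem summand_eq_zero {ς : Qq} {a b c : ℤ} (h : a < 0 ∨ b < 0 ∨ c < 0) (n : ℤ) :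
    summand ς n a b c = 0 := by
  rw [summand]
  rcases h with h | h | h
  · rw [triMon_of_neg_left _ h, smul_zero]
  · rw [triMon_of_neg_right _ h, smul_zero]
  · simp [triMon, hBinomZ, extZ_of_neg _ h]

theorem EchPass_eq_zero {ς : Qq} {a b c : ℤ} (h : a < 0 ∨ b < -1 ∨ c < 0) (n : ℤ) :
    EchPass ς n a b c = 0 := by
  rw [EchPass]
  rcases h with h | h | h
  · rw [triMon_of_neg_left _ h, smul_zero]
  · rw [triMon_of_neg_right _ (by omega), smul_zero]
  · simp [triMon, hBinomZ, extZ_of_neg _ h]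

theorem EchComm_eq_zero {ς : Qq} {a b c : ℤ} (h : a < 0 ∨ b < 0 ∨ c < 0) (n : ℤ) :
    EchComm ς n a b c = 0 := by
  rw [EchComm]
  rcases h with h | h | h
  · rw [triMon_of_neg_left _ (by omega), smul_zero]
  · rw [triMon_of_neg_right _ h, smul_zero]
  · simp [triMon, hBinomZ, extZ_of_neg _ h]

theorem hasFiniteSupport_tmul {ς : Qq} {g : ℤ → ℤ → ℤ → U} (n : ℤ)
    (hg : ∀ a b c : ℤ, a < -1 ∨ b < -1 ∨ c < -1 → g a b c = 0) :
    (fun p : ℤ × ℤ × ℤ =>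
      extZ (Bev ς) (n - p.1 - p.2.1 - 2 * p.2.2) ⊗ₜ[Qq] g p.1 p.2.1 p.2.2).HasFiniteSupport := by
  refine hasFiniteSupport_of_bounds n fun a b c h => ?_
  by_cases h' : a < -1 ∨ b < -1 ∨ c < -1
  · simp only [hg a b c h', TensorProduct.tmul_zero]
  · simp only
    rw [extZ_of_neg _ (by omega), TensorProduct.zero_tmul]

theorem comulTerm_hasFiniteSupport (ς : Qq) (n : ℤ) : (comulTerm ς n).HasFiniteSupport :=
  hasFiniteSupport_tmul n fun _ _ _ h => summand_eq_zero (by omega) n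

theorem finsum_add_sub_right {G M : Type*} [AddGroup G] [AddCommMonoid M] {f g : G → M}
    (hf : f.HasFiniteSupport) (hg : g.HasFiniteSupport) (v : G) :
    ∑ᶠ p, (f p + g p) = ∑ᶠ p, (f p + g (p - v)) := by
  have hg' : (fun p => g (p - v)).HasFiniteSupport :=
    hg.fun_comp_of_injective (Equiv.subRight v).injective
  rw [finsum_add_distrib hf hg, finsum_add_distrib hf hg']
  congr 1
  exact (finsum_comp_equiv (Equiv.subRight v)).symm

/-- Sums over a group are translation invariant, so each family may be shifted by its own vector;
finite support justifies splitting the sum. -/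
theorem finsum_add₅_sub_right {G M : Type*} [AddGroup G] [AddCommMonoid M]
    {f₁ f₂ f₃ f₄ f₅ : G → M} (h₁ : f₁.HasFiniteSupport) (h₂ : f₂.HasFiniteSupport)
    (h₃ : f₃.HasFiniteSupport) (h₄ : f₄.HasFiniteSupport) (h₅ : f₅.HasFiniteSupport)
    (v₂ v₃ v₄ v₅ : G) :
    ∑ᶠ p, (f₁ p + f₂ p + f₃ p + f₄ p + f₅ p) =
      ∑ᶠ p, (f₁ p + f₂ (p - v₂) + f₃ (p - v₃) + f₄ (p - v₄) + f₅ (p - v₅)) := by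
  have e (v : G) : Function.Injective fun p => p - v := (Equiv.subRight v).injective
  have h₂' := h₂.fun_comp_of_injective (e v₂)
  have h₃' := h₃.fun_comp_of_injective (e v₃)
  have h₄' := h₄.fun_comp_of_injective (e v₄)
  have h₅' := h₅.fun_comp_of_injective (e v₅)
  calc
    _ = ∑ᶠ p, (f₁ p + f₂ p + f₃ p + f₄ p + f₅ (p - v₅)) :=
      finsum_add_sub_right (((h₁.add h₂).add h₃).add h₄) h₅ v₅
    _ = ∑ᶠ p, (f₁ p + f₂ p + f₃ p + f₅ (p - v₅) + f₄ (p - v₄)) := by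
      simp only [add_right_comm _ (f₄ _)]
      exact finsum_add_sub_right (((h₁.add h₂).add h₃).add h₅') h₄ v₄
    _ = ∑ᶠ p, (f₁ p + f₂ p + f₅ (p - v₅) + f₄ (p - v₄) + f₃ (p - v₃)) := by
      simp only [add_right_comm _ (f₃ _)]
      exact finsum_add_sub_right (((h₁.add h₂).add h₅').add h₄') h₃ v₃
    _ = ∑ᶠ p, (f₁ p + f₅ (p - v₅) + f₄ (p - v₄) + f₃ (p - v₃) + f₂ (p - v₂)) := by
      simp only [add_right_comm _ (f₂ _)]
      exact finsum_add_sub_right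
        (((h₁.add h₅').add h₄').add h₃') h₂ v₂
    _ = _ := finsum_congr fun p => by abel

theorem comul_B_mul_comulTerm (ς : Qq) (n : ℤ) (p : ℤ × ℤ × ℤ) :
    comul (B ς) * comulTerm ς n p =
      extZ (Bev ς) (n + 1 - p.1 - p.2.1 - 2 * p.2.2) ⊗ₜ[Qq]
        (qInt (n + 1 - p.1 - p.2.1 - 2 * p.2.2) •
          (((K⁻¹ : Uˣ) : U) * summand ς n p.1 p.2.1 p.2.2)) +
      extZ (Bev ς) (n - 1 - p.1 - p.2.1 - 2 * p.2.2) ⊗ₜ[Qq]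
        ((if Even (n - p.1 - p.2.1) then q * ς * qInt (n - p.1 - p.2.1 - 2 * p.2.2) else 0) •
          (((K⁻¹ : Uˣ) : U) * summand ς n p.1 p.2.1 p.2.2)) +
      extZ (Bev ς) (n - p.1 - p.2.1 - 2 * p.2.2) ⊗ₜ[Qq] (F * summand ς n p.1 p.2.1 p.2.2) +
      extZ (Bev ς) (n - p.1 - p.2.1 - 2 * p.2.2) ⊗ₜ[Qq] EchPass ς n p.1 p.2.1 p.2.2 +
      extZ (Bev ς) (n - p.1 - p.2.1 - 2 * p.2.2) ⊗ₜ[Qq] EchComm ς n p.1 p.2.1 p.2.2 := by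
  obtain ⟨a, b, c⟩ := p
  have he : Even (n - a - b - 2 * c) ↔ Even (n - a - b) := by
    rw [Int.even_sub]; simp
  simp only [comul_B, comulTerm, add_mul, Algebra.TensorProduct.tmul_mul_tmul, one_mul,
    B_mul_extZ_Bev, Echeck_mul_summand, TensorProduct.add_tmul, TensorProduct.tmul_add, he]
  rw [show n - a - b - 2 * c + 1 = n + 1 - a - b - 2 * c by ring,
    show n - a - b - 2 * c - 1 = n - 1 - a - b - 2 * c by ring]
  simp only [TensorProduct.tmul_smul, TensorProduct.smul_tmul']
  abel

theorem comul_B_mul_finsum (ς : Qq) (n : ℤ) : comul (B ς) * ∑ᶠ p, comulTerm ς n p =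
    ∑ᶠ p : ℤ × ℤ × ℤ, extZ (Bev ς) (n + 1 - p.1 - p.2.1 - 2 * p.2.2) ⊗ₜ[Qq]
      (qInt (n + 1 - p.1 - p.2.1 - 2 * p.2.2) •
          (((K⁻¹ : Uˣ) : U) * summand ς n p.1 p.2.1 p.2.2) +
        (if Even (n - p.1 - p.2.1) then q * ς * qInt (n + 2 - p.1 - p.2.1 - 2 * p.2.2) else 0) •
          (((K⁻¹ : Uˣ) : U) * summand ς n p.1 p.2.1 (p.2.2 - 1)) +
        F * summand ς n (p.1 - 1) p.2.1 p.2.2 + EchPass ς n p.1 (p.2.1 - 1) p.2.2 +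
        EchComm ς n (p.1 + 1) p.2.1 (p.2.2 - 1)) := by
  have hs {g : ℤ → ℤ → ℤ → U} := hasFiniteSupport_tmul (ς := ς) (g := g)
  have h1 := hs (g := fun a b c => qInt (n + 1 - a - b - 2 * c) •
    (((K⁻¹ : Uˣ) : U) * summand ς n a b c)) (n + 1)
    fun a b c h => by
      simp only [summand_eq_zero (show a < 0 ∨ b < 0 ∨ c < 0 by omega), mul_zero, smul_zero]
  have h2 := hs (g := fun a b c =>
    (if Even (n - a - b) then q * ς * qInt (n - a - b - 2 * c) else 0) •
    (((K⁻¹ : Uˣ) : U) * summand ς n a b c)) (n - 1)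
    fun a b c h => by
      simp only [summand_eq_zero (show a < 0 ∨ b < 0 ∨ c < 0 by omega), mul_zero, smul_zero]
  have h3 := hs (g := fun a b c => F * summand ς n a b c) n
    fun a b c h => by
      simp only [summand_eq_zero (show a < 0 ∨ b < 0 ∨ c < 0 by omega), mul_zero]
  have h4 := hs (g := EchPass ς n) n fun a b c h => EchPass_eq_zero (by omega) n
  have h5 := hs (g := EchComm ς n) n fun a b c h => EchComm_eq_zero (by omega) n
  rw [mul_finsum' _ _ (comulTerm_hasFiniteSupport ς n)]
  simp only [comul_B_mul_comulTerm]
  -- The shifts record the effect of each term: lowering the B_ev index by one costs a unit of c, F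
  -- raises a, Ě passing through raises b, and the commutator lowers a while c rises. Every left
  -- factor becomes B_ev^(n+1-a-b-2c).
  refine (finsum_add₅_sub_right h1 h2 h3 h4 h5 (0, 0, 1) (1, 0, 0) (0, 1, 0) (-1, 0, 1)).trans
    (finsum_congr ?_)
  rintro ⟨a, b, c⟩
  simp only [Prod.mk_sub_mk, sub_zero, sub_neg_eq_add, TensorProduct.tmul_add]
  rw [show n - 1 - a - b - 2 * (c - 1) = n + 1 - a - b - 2 * c by ring,
    show n - a - b - 2 * (c - 1) = n + 2 - a - b - 2 * c by ring,
    show n - (a - 1) - b - 2 * c = n + 1 - a - b - 2 * c by ring,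
    show n - a - (b - 1) - 2 * c = n + 1 - a - b - 2 * c by ring,
    show n - (a + 1) - b - 2 * (c - 1) = n + 1 - a - b - 2 * c by ring]

theorem comul_B_mul_finsum_of_odd {ς : Qq} (hς : ς ≠ 0) {n : ℤ} (hn : ¬ Even n) :
    comul (B ς) * ∑ᶠ p, comulTerm ς n p = qInt (n + 1) • ∑ᶠ p, comulTerm ς (n + 1) p := by
  rw [comul_B_mul_finsum, smul_finsum' _ (comulTerm_hasFiniteSupport ς _)]
  refine finsum_congr fun p => ?_
  rw [← summand_recursion_of_odd hς hn, TensorProduct.tmul_smul, comulTerm]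

theorem comul_B_mul_finsum_of_even {ς : Qq} (hς : ς ≠ 0) {n : ℤ} (hn : Even n) :
    comul (B ς) * ∑ᶠ p, comulTerm ς n p = qInt (n + 1) • ∑ᶠ p, comulTerm ς (n + 1) p +
      (q * ς * qInt n) • ∑ᶠ p, comulTerm ς (n - 1) p := by
  have h := comulTerm_hasFiniteSupport ς (n + 1)
  have h' := comulTerm_hasFiniteSupport ς (n - 1)
  have hs := h.fun_comp (g := (qInt (n + 1) • ·)) (smul_zero _)
  have hs' := h'.fun_comp (g := ((q * ς * qInt n) • ·)) (smul_zero _)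
  -- Shifting c by one in the n-1 sum gives it the left factors of the n+1 sum.
  rw [comul_B_mul_finsum, smul_finsum' _ h, smul_finsum' _ h', ← finsum_add_distrib hs hs',
    finsum_add_sub_right hs hs' (0, 0, 1)]
  refine finsum_congr ?_
  rintro ⟨a, b, c⟩
  rw [← summand_recursion_of_even hς hn, TensorProduct.tmul_add, TensorProduct.tmul_smul,
    TensorProduct.tmul_smul]
  simp only [comulTerm, Prod.mk_sub_mk, sub_zero]
  rw [show n - 1 - a - b - 2 * (c - 1) = n + 1 - a - b - 2 * c by ring]

/-! ### The induction and the return to finite sums -/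

theorem qInt_natCast_succ_ne_zero (n : ℕ) : qInt ((n : ℤ) + 1) ≠ 0 := by
  exact_mod_cast qInt_ne_zero n.succ_ne_zero

theorem finsum_comulTerm_zero (ς : Qq) : ∑ᶠ p, comulTerm ς 0 p = 1 := by
  rw [finsum_eq_single _ (0, 0, 0)]
  · simp [comulTerm, summand, wt, triMon, hBinomZ, extZ, divPow, qFact, Bev_zero, hBinom,
      Algebra.TensorProduct.one_def]
  · rintro ⟨a, b, c⟩ h
    simp only [comulTerm]
    by_cases h' : a < 0 ∨ b < 0 ∨ c < 0
    · rw [summand_eq_zero h', TensorProduct.tmul_zero]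
    · rw [extZ_of_neg _ (by simp only [ne_eq, Prod.mk.injEq] at h; omega),
        TensorProduct.zero_tmul]

theorem comul_Bev_eq_finsum {ς : Qq} (hς : ς ≠ 0) (n : ℕ) :
    comul (Bev ς n) = ∑ᶠ p, comulTerm ς n p := by
  induction n using Nat.strong_induction_on with
  | _ n ih =>
  obtain _ | n := n
  · rw [Nat.cast_zero, finsum_comulTerm_zero, Bev_zero, map_one]
  have hB := congrArg comul (B_mul_extZ_Bev ς n)
  have hn : extZ (Bev ς) ((n : ℤ) + 1) = Bev ς (n + 1) := extZ_natCast _ (n + 1)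
  rw [extZ_natCast, hn, map_mul, map_add, map_smul, map_smul, ih n n.lt_succ_self] at hB
  -- The recursion determines [n+1] Δ(B_ev^(n+1)), and [n+1] is invertible.
  refine smul_right_injective _ (qInt_natCast_succ_ne_zero n) ?_
  simp only [Nat.cast_succ]
  by_cases h : Even (n : ℤ)
  · rw [comul_B_mul_finsum_of_even hς h, if_pos h] at hB
    -- For n = 0 there is no earlier case to invoke, but the lower term has coefficient [0] = 0.
    obtain _ | m := n
    · simpa [qInt_zero] using hB.symm
    · rw [show ((m + 1 : ℕ) : ℤ) - 1 = m by push_cast; ring, extZ_natCast, ih m (by omega)] at hB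
      exact (add_right_cancel hB).symm
  · rw [comul_B_mul_finsum_of_odd hς h, if_neg h, zero_smul, add_zero] at hB
    exact hB.symm

theorem finsum_comulTerm_eq_sum (ς : Qq) (n : ℕ) : ∑ᶠ p, comulTerm ς n p =
    ∑ r ∈ Finset.range (n + 1), Bev ς (n - r) ⊗ₜ[Qq]
      (∑ c ∈ Finset.range (r / 2 + 1), ∑ a ∈ Finset.range (r - 2 * c + 1),
        summand ς n a ((r : ℤ) - 2 * c - a) c) := by
  classical
  simp only [TensorProduct.tmul_sum, Finset.sum_sigma']
  set I := (Finset.range (n + 1)).sigma fun r => (Finset.range (r / 2 + 1)).sigma fun c =>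
    Finset.range (r - 2 * c + 1)
  -- The change of indices (r, c, a) ↦ (a, b, c) with b = r - 2c - a; its image contains the
  -- support.
  let φ : (Σ _ : ℕ, Σ _ : ℕ, ℕ) → ℤ × ℤ × ℤ := fun x =>
    (x.2.2, (x.1 : ℤ) - 2 * x.2.1 - x.2.2, x.2.1)
  have hφ : Function.Injective φ := by
    rintro ⟨r, c, a⟩ ⟨r', c', a'⟩ h
    simp only [φ, Prod.mk.injEq] at h
    obtain rfl : c = c' := by omega
    obtain rfl : a = a' := by omega
    obtain rfl : r = r' := by omega
    rfl
  rw [finsum_eq_finsetSum_of_support_subset (s := I.image φ), Finset.sum_image hφ.injOn]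
  · refine Finset.sum_congr rfl ?_
    rintro ⟨r, c, a⟩ h
    simp only [I, Finset.mem_sigma, Finset.mem_range] at h
    simp only [comulTerm, φ]
    rw [show (n : ℤ) - a - ((r : ℤ) - 2 * c - a) - 2 * c = (n - r : ℕ) by omega, extZ_natCast]
  · rintro ⟨a, b, c⟩ h
    have h1 : ¬ (a < 0 ∨ b < 0 ∨ c < 0) := fun h' =>
      h (by simp only [comulTerm]; rw [summand_eq_zero h', TensorProduct.tmul_zero])
    have h2 : ¬ ((n : ℤ) - a - b - 2 * c < 0) := fun h' =>
      h (by simp only [comulTerm]; rw [extZ_of_neg _ h', TensorProduct.zero_tmul])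
    simp only [Finset.coe_image, Set.mem_image, Finset.mem_coe]
    refine ⟨⟨(a + b + 2 * c).toNat, c.toNat, a.toNat⟩, ?_, ?_⟩
    · simp only [I, Finset.mem_sigma, Finset.mem_range]
      omega
    · simp only [φ, Prod.mk.injEq]
      omega

theorem floor_ratCast_div_two (m : ℤ) : ⌊(m : ℚ) / 2⌋ = m / 2 := by
  exact_mod_cast Rat.floor_intCast_div_natCast m 2

theorem summand_eq {ς : Qq} {n r c a : ℕ} (hc : c < r / 2 + 1) (ha : a < r - 2 * c + 1) :
    summand ς n a ((r : ℤ) - 2 * c - a) c =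
      ((-1) ^ c * q ^ ((if Even (n : ℤ) then 3 else 1) * (c : ℤ) -
        ((r : ℤ) - 2 * c) * ((r : ℤ) - n) + (a : ℤ) * ((r : ℤ) - 2 * c - a)) * (q * ς) ^ c) •
      (divPow F a * hBinom (shiftIdx n ((r : ℤ) - 2 * c)) c * ((K ^ ((r : ℤ) - n) : Uˣ) : U) *
        divPow (Echeck ς) (r - 2 * c - a)) := by
  rw [summand, triMon, wt, show (a : ℤ) + ((r : ℤ) - 2 * c - a) = (r : ℤ) - 2 * c by ring,
    show (r : ℤ) - 2 * c + 2 * c - n = r - n by ring,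
    show (r : ℤ) - 2 * c - a = (r - 2 * c - a : ℕ) by omega, hBinomZ, extZ_natCast, extZ_natCast,
    extZ_natCast, zpow_natCast, neg_pow]
  congr 1
  ring

end QSl2

end

theorem mainTheorem5 (ς : QSl2.Qq) (hς : ς ≠ 0) :
    (∀ n : ℕ, Even n →
      QSl2.comul (QSl2.Bev ς n) =
        ∑ r ∈ Finset.range (n + 1), QSl2.Bev ς (n - r) ⊗ₜ[QSl2.Qq]
          (∑ c ∈ Finset.range (r / 2 + 1), ∑ a ∈ Finset.range (r - 2 * c + 1),
            ((-1) ^ c *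
              QSl2.q ^ (3 * (c : ℤ) - ((r : ℤ) - 2 * c) * ((r : ℤ) - n)
                + (a : ℤ) * ((r : ℤ) - 2 * c - a)) *
              (QSl2.q * ς) ^ c) •
            (QSl2.divPow QSl2.F a *
              QSl2.hBinom (1 - (c : ℤ) + ⌊((r : ℚ) - 2) / 2⌋) c *
              ((QSl2.K ^ ((r : ℤ) - n) : QSl2.Uˣ) : QSl2.U) *
              QSl2.divPow (QSl2.Echeck ς) (r - 2 * c - a)))) ∧
    (∀ n : ℕ, Odd n →
      QSl2.comul (QSl2.Bev ς n) =
        ∑ r ∈ Finset.range (n + 1), QSl2.Bev ς (n - r) ⊗ₜ[QSl2.Qq]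
          (∑ c ∈ Finset.range (r / 2 + 1), ∑ a ∈ Finset.range (r - 2 * c + 1),
            ((-1) ^ c *
              QSl2.q ^ ((c : ℤ) - ((r : ℤ) - 2 * c) * ((r : ℤ) - n)
                + (a : ℤ) * ((r : ℤ) - 2 * c - a)) *
              (QSl2.q * ς) ^ c) •
            (QSl2.divPow QSl2.F a *
              QSl2.hBinom (1 - (c : ℤ) + ⌊((r : ℚ) - 1) / 2⌋) c *
              ((QSl2.K ^ ((r : ℤ) - n) : QSl2.Uˣ) : QSl2.U) *
              QSl2.divPow (QSl2.Echeck ς) (r - 2 * c - a)))) := by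
  constructor
  · intro n hn
    rw [QSl2.comul_Bev_eq_finsum hς, QSl2.finsum_comulTerm_eq_sum]
    refine Finset.sum_congr rfl fun r _ => congrArg _ <| Finset.sum_congr rfl fun c hc =>
      Finset.sum_congr rfl fun a ha => ?_
    have hf : ⌊((r : ℚ) - 2) / 2⌋ = ((r : ℤ) - 2) / 2 := by
      exact_mod_cast QSl2.floor_ratCast_div_two ((r : ℤ) - 2)
    have hn' : Even (n : ℤ) := by exact_mod_cast hn
    -- The stated shift depends only on a + b = r - 2c, since c can be moved inside the floor.
    rw [QSl2.summand_eq (Finset.mem_range.1 hc) (Finset.mem_range.1 ha), QSl2.shiftIdx, hf,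
      if_pos hn', if_pos hn',
      show ((r : ℤ) - 2 * c) / 2 = 1 - (c : ℤ) + ((r : ℤ) - 2) / 2 by omega]
  · intro n hn
    rw [QSl2.comul_Bev_eq_finsum hς, QSl2.finsum_comulTerm_eq_sum]
    refine Finset.sum_congr rfl fun r _ => congrArg _ <| Finset.sum_congr rfl fun c hc =>
      Finset.sum_congr rfl fun a ha => ?_
    have hf : ⌊((r : ℚ) - 1) / 2⌋ = ((r : ℤ) - 1) / 2 := by
      exact_mod_cast QSl2.floor_ratCast_div_two ((r : ℤ) - 1)
    have hn' : ¬ Even (n : ℤ) := by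
      rw [Int.not_even_iff_odd]
      exact_mod_cast hn
    rw [QSl2.summand_eq (Finset.mem_range.1 hc) (Finset.mem_range.1 ha), QSl2.shiftIdx, hf,
      if_neg hn', if_neg hn', one_mul,
      show ((r : ℤ) - 2 * c + 1) / 2 = 1 - (c : ℤ) + ((r : ℤ) - 1) / 2 by omega]
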